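/- Let $n,k,\ell\ge 0$ be integers with $k+\ell\le 2n$ and let $\tau\in\mathbb R$. Let $\gamma_1,\dots,\gamma_{2n}$ be the $n$-mode Majorana operators in the Jordan–Wigner representation, $\gamma_{2a-1}=Z^{\otimes a-1}\otimes X\otimes \mathbb 1^{\otimes n-a}$ and $\gamma_{2a}=Z^{\otimes a-1}\otimes Y\otimes \mathbb 1^{\otimes n-a}$ for $1\le a\le n$. The correlation matrix of a $2^n\times 2^n$ unitary $U$ is the real $2n\times 2n$ matrix $M$ with $M_{ab}=2^{-n}\operatorname{tr}(\gamma_a U\gamma_b U^\dagger)$; $\sigma_1(M)\ge\dots\ge\sigma_{2n}(M)$ denote its singular values. A unitary $G$ is the Gaussian unitary corresponding to an orthogonal matrix $V\in O(2n)$ (it is determined by $V$ up to a phase) if $G\gamma_aG^\dagger=\sum_b V_{ba}\gamma_b$ for all $a$. A unitary $U$ has Gaussian dimension (at least) $m$ if there are operators $\eta_1,\dots,\eta_m$, each of the form $\eta_a=\sum_b C_{ba}\gamma_b$ with $C_{ba}$ real and $\sum_b C_{ba}^2=1$, such that $\operatorname{tr}(\eta_a\eta_{a'})=0$ for $a\ne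 a'$ and each $U\eta_aU^\dagger$ is of the form $\sum_b C'_{ba}\gamma_b$ with $C'_{ba}$ real and $\sum_b (C'_{ba})^2=1$. The Frobenius distance is $d_F(U,V)=\frac{1}{\sqrt{2\cdot 2^n}}\min_{\theta\in[0,2\pi)}\|U-e^{i\theta}V\|_F$. **Lemma.** Let $U$ be an $n$-mode unitary ($2^n\times 2^n$) whose correlation matrix $M$ has a singular value decomposition $M=V_A\Sigma V_B^{\mathsf T}$, where $V_A,V_B\in O(2n)$ and $\Sigma=\operatorname{diag}(\sigma_1(M),\dots,\sigma_{2n}(M))$, and let $G_A,G_B$ be Gaussian unitaries corresponding to $V_A,V_B$, respectively. Suppose $\sigma_1(M)=\dots=\sigma_k(M)=1$ and, if $k+\ell\ge1$, $\sigma_{k+\ell}(M)\ge 1-\tau$. Then there exist a unitary $u'$ on $n-\lfloor (k+\ell)/2\rfloor$ modes and a unitary $U'=G_A(\mathbb 1\otimes u')G_B^\dagger$, where $\mathbb 1$ is the identity on the first $\lfloor (k+\ell)/2\rfloor$ modes and $u'$ acts on the last $n-\lfloor (k+\ell)/2\rfloor$ modes, such that $U'$ has Gaussian dimension (at least) $k+\ell$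 and $$d_F(U,U')\le 2\sqrt{\ell\tau}.$$ -/

import Mathlib

noncomputable section

namespace Fermion

open Matrix Complex
open scoped Kronecker

/-- Operators on `n` modes (`n` qubits): `2 ^ n × 2 ^ n` complex matrices, with rows and columns
indexed by the `n`-bit strings. -/
abbrev Operator (n : ℕ) : Type := Matrix (Fin n → Fin 2) (Fin n → Fin 2) ℂ

/-- The tensor product `A 0 ⊗ A 1 ⊗ ⋯ ⊗ A (n - 1)` of one-qubit operators. -/
def siteTensor {n : ℕ} (A : Fin n → Matrix (Fin 2) (Fin 2) ℂ) : Operator n :=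
  Matrix.of fun x y => ∏ j, A j (x j) (y j)

def pauliX : Matrix (Fin 2) (Fin 2) ℂ := !![0, 1; 1, 0]

def pauliY : Matrix (Fin 2) (Fin 2) ℂ := !![0, -I; I, 0]

def pauliZ : Matrix (Fin 2) (Fin 2) ℂ := !![1, 0; 0, -1]

/-- The Majorana operators `γ_1, …, γ_{2n}` in the Jordan–Wigner representation, numbered from
`0`: `γ_{2j+1} = Z^{⊗ j} ⊗ X ⊗ 1 ⊗ ⋯ ⊗ 1` is `majorana n (2 * j)`, and
`γ_{2j+2} = Z^{⊗ j} ⊗ Y ⊗ 1 ⊗ ⋯ ⊗ 1` is `majorana n (2 * j + 1)`, for `j = 0, …, n - 1`. -/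
def majorana (n : ℕ) (a : Fin (2 * n)) : Operator n :=
  siteTensor fun j =>
    if (j : ℕ) < (a : ℕ) / 2 then pauliZ
    else if (j : ℕ) = (a : ℕ) / 2 then (if (a : ℕ) % 2 = 0 then pauliX else pauliY)
    else 1

/-- The real linear combination `∑ b, c b γ_b` of Majorana operators. -/
def majoranaComb {n : ℕ} (c : Fin (2 * n) → ℝ) : Operator n :=
  ∑ b, (c b : ℂ) • majorana n b

/-- The correlation matrix `M_{ab} = 2^{-n} tr(γ_a U γ_b U†)`. The trace is real, see
`ofReal_correlationMatrix`. -/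
def correlationMatrix {n : ℕ} (U : Operator n) : Matrix (Fin (2 * n)) (Fin (2 * n)) ℝ :=
  Matrix.of fun a b => ((2 : ℝ) ^ n)⁻¹ * (majorana n a * (U * majorana n b * Uᴴ)).trace.re

theorem majorana_isHermitian (n : ℕ) (a : Fin (2 * n)) : (majorana n a)ᴴ = majorana n a := by
  have hX : ∀ i j, star (pauliX j i) = pauliX i j := by
    intro i j; fin_cases i <;> fin_cases j <;> simp [pauliX]
  have hY : ∀ i j, star (pauliY j i) = pauliY i j := by
    intro i j; fin_cases i <;> fin_cases j <;> simp [pauliY]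
  have hZ : ∀ i j, star (pauliZ j i) = pauliZ i j := by
    intro i j; fin_cases i <;> fin_cases j <;> simp [pauliZ]
  have h1 : ∀ i j, star ((1 : Matrix (Fin 2) (Fin 2) ℂ) j i)
      = (1 : Matrix (Fin 2) (Fin 2) ℂ) i j := by
    intro i j; fin_cases i <;> fin_cases j <;> simp
  ext x y
  simp only [majorana, siteTensor, Matrix.conjTranspose_apply, Matrix.of_apply, star_prod]
  refine Finset.prod_congr rfl fun j _ => ?_
  split_ifs
  · exact hZ _ _
  · exact hX _ _
  · exact hY _ _
  · exact h1 _ _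

theorem ofReal_correlationMatrix {n : ℕ} (U : Operator n) (a b : Fin (2 * n)) :
    (correlationMatrix U a b : ℂ)
      = ((2 : ℂ) ^ n)⁻¹ * (majorana n a * (U * majorana n b * Uᴴ)).trace := by
  have h : star (majorana n a * (U * majorana n b * Uᴴ)).trace
      = (majorana n a * (U * majorana n b * Uᴴ)).trace := by
    rw [← Matrix.trace_conjTranspose]
    simp only [Matrix.conjTranspose_mul, Matrix.conjTranspose_conjTranspose, majorana_isHermitian]
    rw [Matrix.trace_mul_comm, Matrix.mul_assoc U]
  have h2 := (Complex.conj_eq_iff_re (z := _)).1 h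
  simp only [correlationMatrix, Matrix.of_apply]
  push_cast
  rw [h2]

/-- `G` is a Gaussian unitary, and `V` is the orthogonal matrix to which it corresponds:
`G γ_a G† = ∑ b, V_{ba} γ_b` for all `a`. -/
def IsGaussianOf {n : ℕ} (G : Operator n) (V : Matrix (Fin (2 * n)) (Fin (2 * n)) ℝ) : Prop :=
  G ∈ Matrix.unitaryGroup (Fin n → Fin 2) ℂ ∧
  V ∈ Matrix.orthogonalGroup (Fin (2 * n)) ℝ ∧
  ∀ a, G * majorana n a * Gᴴ = majoranaComb fun b => V b a

/-- `U` has Gaussian dimension (at least) `k`: it conjugates `k` mutually orthogonal rotated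
Majorana operators `η_1, …, η_k` into rotated Majorana operators. Column `a` of `C` holds the
coefficients of `η_a`, and column `a` of `C'` those of `U η_a U†`. -/
def HasGaussianDimension {n : ℕ} (U : Operator n) (k : ℕ) : Prop :=
  ∃ C C' : Matrix (Fin (2 * n)) (Fin k) ℝ,
    (∀ a, ∑ b, C b a ^ 2 = 1) ∧
    (∀ a a', a ≠ a' →
      ((majoranaComb fun b => C b a) * (majoranaComb fun b => C b a')).trace = 0) ∧
    (∀ a, ∑ b, C' b a ^ 2 = 1 ∧
      U * (majoranaComb fun b => C b a) * Uᴴ = majoranaComb fun b => C' b a)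

/-- The `n`-mode operator `1 ⊗ u`: the identity on the first `m` modes, and the operator `u` on
the last `n - m` modes. -/
def idTensor {n : ℕ} (m : ℕ) (hm : m ≤ n) (u : Operator (n - m)) : Operator n :=
  ((1 : Operator m) ⊗ₖ u).submatrix
    (fun x => (fun i => x ⟨i, by omega⟩, fun i => x ⟨m + i, by omega⟩))
    (fun x => (fun i => x ⟨i, by omega⟩, fun i => x ⟨m + i, by omega⟩))

/-- The singular values `σ_1(M) ≥ σ_2(M) ≥ ⋯` of a square real matrix, numbered from `1`. -/
def sigma {d : ℕ} (M : Matrix (Fin d) (Fin d) ℝ) (a : ℕ) : ℝ :=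
  (Matrix.toEuclideanLin M).singularValues (a - 1)

open scoped Matrix.Norms.Frobenius in
/-- The phase-invariant Frobenius distance
`(2 d)^{-1/2} min_{θ ∈ [0, 2π)} ‖U - e^{iθ} V‖_F` of two `d × d` matrices, with `d = 2 ^ n`. -/
def frobeniusDist {n : ℕ} (U V : Operator n) : ℝ :=
  (√(2 * (2 : ℝ) ^ n))⁻¹ *
    ⨅ θ : Set.Ico (0 : ℝ) (2 * Real.pi), ‖U - Complex.exp ((θ : ℝ) * I) • V‖

end Fermion

end

/-! Put `X = G_A† U G_B`. The singular value decomposition makes the correlation matrix of `X`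
diagonal, so `⟨X, γ_a X γ_a⟩ = 2^n σ_a` and `‖X - γ_a X γ_a‖² / 4 = 2^n (1 - σ_a) / 2`. Summed over
the first `k + ℓ` indices, these defects are at most `δ = 2^n ℓ τ / 2`.

Averaging `X` over the conjugations by those Majoranas projects it onto their commutant
(`exists_commutant_projection`). The result `E` is a contraction with `‖X - E‖² = ‖X‖² - ‖E‖² ≤ δ`.
After a small perturbation making it invertible, its unitary polar factor `W` still commutes with
the Majoranas, and `‖X - W‖² ≤ 5δ` (`exists_unitary_commute_majorana`).

Commuting with the first `2m` Majoranas forces `W = 1 ⊗ u`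
(`exists_eq_idTensor_of_commute_majorana`). Commuting with all `k + ℓ` of them gives the Gaussian
dimension of `U' = G_A W G_B†`. The distance is then at most `√(5/4) √(ℓτ)`. -/

noncomputable section

namespace Fermion

open Matrix Complex

/-! ### Hilbert–Schmidt geometry, contractions and polar factors. -/

section HilbertSchmidt

variable {d : Type*} [Fintype d]

/-- The real Hilbert–Schmidt inner product `Re tr(A† B)`. -/
def hsInner (A B : Matrix d d ℂ) : ℝ := (Aᴴ * B).trace.re

theorem hsInner_comm (A B : Matrix d d ℂ) : hsInner A B = hsInner B A := by
  have h : (Aᴴ * B).trace = star (Bᴴ * A).trace := by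
    rw [← trace_conjTranspose, conjTranspose_mul, conjTranspose_conjTranspose]
  rw [hsInner, h, hsInner]
  exact Complex.conj_re _

theorem hsInner_add_left (A B C : Matrix d d ℂ) :
    hsInner (A + B) C = hsInner A C + hsInner B C := by
  simp [hsInner, add_mul]

theorem hsInner_sub_left (A B C : Matrix d d ℂ) :
    hsInner (A - B) C = hsInner A C - hsInner B C := by
  simp [hsInner, sub_mul]

theorem hsInner_add_right (A B C : Matrix d d ℂ) :
    hsInner A (B + C) = hsInner A B + hsInner A C := by
  simp [hsInner, mul_add]

theorem hsInner_sub_right (A B C : Matrix d d ℂ) :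
    hsInner A (B - C) = hsInner A B - hsInner A C := by
  simp [hsInner, mul_sub]

theorem hsInner_smul_left (r : ℝ) (A B : Matrix d d ℂ) :
    hsInner ((r : ℂ) • A) B = r * hsInner A B := by
  simp [hsInner]

theorem hsInner_smul_right (r : ℝ) (A B : Matrix d d ℂ) :
    hsInner A ((r : ℂ) • B) = r * hsInner A B := by
  simp [hsInner]

open scoped Matrix.Norms.Frobenius in
theorem frobenius_norm_sq_eq_hsInner (A : Matrix d d ℂ) : ‖A‖ ^ 2 = hsInner A A := by
  have h0 : 0 ≤ ∑ i, ∑ j, ‖A i j‖ ^ (2 : ℝ) := by positivity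
  rw [frobenius_norm_def, ← Real.sqrt_eq_rpow, Real.sq_sqrt h0, hsInner, trace, re_sum,
    Finset.sum_comm]
  refine Finset.sum_congr rfl fun j _ => ?_
  rw [diag_apply, mul_apply, re_sum]
  refine Finset.sum_congr rfl fun i _ => ?_
  rw [conjTranspose_apply, Real.rpow_two, ← Complex.normSq_eq_norm_sq]
  simp [Complex.normSq_apply]

theorem hsInner_self_nonneg (A : Matrix d d ℂ) : 0 ≤ hsInner A A := by
  open scoped Matrix.Norms.Frobenius in
  rw [← frobenius_norm_sq_eq_hsInner]
  positivity

theorem eq_zero_of_hsInner_self_nonpos {A : Matrix d d ℂ} (h : hsInner A A ≤ 0) : A = 0 := by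
  open scoped Matrix.Norms.Frobenius in
  rw [← frobenius_norm_sq_eq_hsInner] at h
  exact norm_eq_zero.1 (pow_eq_zero_iff two_ne_zero |>.1 (le_antisymm h (sq_nonneg _)))

variable [DecidableEq d]

theorem hsInner_self_of_mem_unitaryGroup {W : Matrix d d ℂ} (hW : W ∈ unitaryGroup d ℂ) :
    hsInner W W = Fintype.card d := by
  have h : Wᴴ * W = 1 := mem_unitaryGroup_iff'.1 hW
  simp [hsInner, h]

theorem hsInner_unitary_mul_mul {V W : Matrix d d ℂ} (hV : V ∈ unitaryGroup d ℂ)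
    (hW : W ∈ unitaryGroup d ℂ) (A B : Matrix d d ℂ) :
    hsInner (V * A * W) (V * B * W) = hsInner A B := by
  have h1 : Vᴴ * V = 1 := mem_unitaryGroup_iff'.1 hV
  have h2 : W * Wᴴ = 1 := mem_unitaryGroup_iff.1 hW
  have h3 : (V * A * W)ᴴ * (V * B * W) = Wᴴ * (Aᴴ * (Vᴴ * V) * B * W) := by
    simp only [conjTranspose_mul, Matrix.mul_assoc]
  rw [hsInner, h3, h1, trace_mul_comm, Matrix.mul_one, Matrix.mul_assoc _ W, h2, Matrix.mul_one,
    hsInner]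

open scoped ComplexOrder in
-- Writing `Z` for the combination, `1 - Z†Z` exceeds the same combination of `1 - X†X` and `1 -
-- Y†Y` by exactly `t (1 - t) (X - Y)†(X - Y)`.
theorem posSemidef_one_sub_of_convex_comb {X Y : Matrix d d ℂ} {t : ℝ} (h0 : 0 ≤ t) (h1 : t ≤ 1)
    (hX : (1 - Xᴴ * X).PosSemidef) (hY : (1 - Yᴴ * Y).PosSemidef) :
    (1 - (((1 - t : ℝ) : ℂ) • X + (t : ℂ) • Y)ᴴ *
      (((1 - t : ℝ) : ℂ) • X + (t : ℂ) • Y)).PosSemidef := by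
  have key : 1 - (((1 - t : ℝ) : ℂ) • X + (t : ℂ) • Y)ᴴ *
      (((1 - t : ℝ) : ℂ) • X + (t : ℂ) • Y) = (1 - t) • (1 - Xᴴ * X) + t • (1 - Yᴴ * Y)
        + (t * (1 - t)) • ((X - Y)ᴴ * (X - Y)) := by
    ext i j
    simp [add_mul, mul_add, sub_mul, mul_sub]
    ring
  rw [key]
  exact ((hX.smul (sub_nonneg.2 h1)).add (hY.smul h0)).add
    ((posSemidef_conjTranspose_mul_self _).smul (mul_nonneg h0 (sub_nonneg.2 h1)))

open scoped MatrixOrder ComplexOrder in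
/-- The unitary factor of the polar decomposition of an invertible contraction. -/
theorem exists_unitary_polar_factor {B : Matrix d d ℂ} (hB : IsUnit B)
    (hB1 : (1 - Bᴴ * B).PosSemidef) :
    ∃ W ∈ unitaryGroup d ℂ, (∀ C, Commute B C → Commute Bᴴ C → Commute W C) ∧
      hsInner (B - W) (B - W) ≤ Fintype.card d - hsInner B B := by
  set P := Bᴴ * B with hP
  have hPu : IsUnit P := hB.star.mul hB
  have hPs : P.PosSemidef := posSemidef_conjTranspose_mul_self B
  have hPsa : IsSelfAdjoint P := hPs.1
  have hpos : ∀ x ∈ spectrum ℝ P, 0 < x := fun x hx =>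
    lt_of_le_of_ne (spectrum_nonneg_of_nonneg hPs.nonneg hx)
      fun h => spectrum.zero_notMem ℝ hPu (h ▸ hx)
  have hle : ∀ x ∈ spectrum ℝ P, x ≤ 1 := by
    have h : P ≤ algebraMap ℝ _ 1 := by rw [map_one]; exact hB1
    exact (le_algebraMap_iff_spectrum_le (ha := hPsa)).1 h
  have hc : ContinuousOn (fun x : ℝ => (√x)⁻¹) (spectrum ℝ P) :=
    Real.continuous_sqrt.continuousOn.inv₀ fun x hx => (Real.sqrt_pos.2 (hpos x hx)).ne'
  -- `Q = P^{-1/2}` with `P = B†B`, so `BQ` is the unitary factor. What commutes with `B` and `B†`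
  -- commutes with `P`, hence with `Q`.
  set Q := cfc (fun x : ℝ => (√x)⁻¹) P with hQ
  have hQh : Qᴴ = Q := (cfc_predicate (fun x : ℝ => (√x)⁻¹) P : IsSelfAdjoint _)
  have hQP : Q * P = cfc (fun x : ℝ => √x) P := by
    conv_lhs => rw [hQ]; rhs; rw [← cfc_id ℝ P]
    rw [← cfc_mul _ _ P hc]
    refine cfc_congr fun x hx => ?_
    have := (Real.sqrt_pos.2 (hpos x hx)).ne'
    field_simp
    exact (Real.sq_sqrt (hpos x hx).le).symm
  have hQPQ : Q * P * Q = 1 := by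
    rw [hQP, hQ, ← cfc_mul _ _ P (by fun_prop) hc, ← cfc_one ℝ P]
    exact cfc_congr fun x hx => mul_inv_cancel₀ (Real.sqrt_pos.2 (hpos x hx)).ne'
  have hW : B * Q ∈ unitaryGroup d ℂ := by
    rw [mem_unitaryGroup_iff', star_eq_conjTranspose, conjTranspose_mul, hQh, ← hQPQ, hP]
    simp only [Matrix.mul_assoc]
  refine ⟨B * Q, hW, fun C hC hC' => ?_, ?_⟩
  · have : Commute P C := hC'.mul_left hC
    exact hC.mul_left (this.cfc_real _)
  -- The squared distance is `N - 2 tr √P + tr P`, where `N` is the dimension. Since `√x ≥ x` on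
  -- `[0, 1]`, `tr √P ≥ tr P`.
  · have h1 : (cfc (fun x : ℝ => √x) P - P).PosSemidef := by
      have : cfc (fun x : ℝ => √x) P - P = cfc (fun x : ℝ => √x - x) P := by
        rw [cfc_sub _ _ P, cfc_id' ℝ P]
      rw [this]
      refine nonneg_iff_posSemidef.1 (cfc_nonneg fun x hx => ?_)
      have h1 := hpos x hx
      have h2 := hle x hx
      rw [sub_nonneg]
      exact Real.le_sqrt_of_sq_le (by nlinarith)
    have h2 := (Complex.le_def.1 h1.trace_nonneg).1
    rw [trace_sub, ← hQP, zero_re, sub_re] at h2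
    have h3 : hsInner (B * Q) B = (Q * P).trace.re := by
      rw [hsInner, conjTranspose_mul, hQh, Matrix.mul_assoc]
    have h4 : hsInner B B = P.trace.re := rfl
    rw [hsInner_sub_left, hsInner_sub_right, hsInner_sub_right,
      hsInner_self_of_mem_unitaryGroup hW, hsInner_comm B (B * Q), h3, h4]
    linarith

end HilbertSchmidt

/-! ### Jordan–Wigner relations. -/

theorem siteTensor_mul {n : ℕ} (A B : Fin n → Matrix (Fin 2) (Fin 2) ℂ) :
    siteTensor A * siteTensor B = siteTensor fun j => A j * B j := by
  ext x y
  simp only [siteTensor, mul_apply, of_apply, ← Finset.prod_mul_distrib]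
  rw [Finset.prod_univ_sum, Fintype.piFinset_univ]

theorem siteTensor_one {n : ℕ} :
    siteTensor (fun _ : Fin n => (1 : Matrix (Fin 2) (Fin 2) ℂ)) = 1 := by
  ext x y
  by_cases h : x = y
  · subst h; simp [siteTensor]
  · obtain ⟨j, hj⟩ := Function.ne_iff.1 h
    rw [one_apply_ne h]
    exact Finset.prod_eq_zero (Finset.mem_univ j) (one_apply_ne hj)

theorem siteTensor_smul {n : ℕ} (c : Fin n → ℂ) (A : Fin n → Matrix (Fin 2) (Fin 2) ℂ) :
    (siteTensor fun j => c j • A j) = (∏ j, c j) • siteTensor A := by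
  ext x y
  simp [siteTensor, Finset.prod_mul_distrib]

theorem pauliX_mul_self : pauliX * pauliX = 1 := by
  ext i j; fin_cases i <;> fin_cases j <;> simp [pauliX]

theorem pauliY_mul_self : pauliY * pauliY = 1 := by
  ext i j; fin_cases i <;> fin_cases j <;> simp [pauliY]

theorem pauliZ_mul_self : pauliZ * pauliZ = 1 := by
  ext i j; fin_cases i <;> fin_cases j <;> simp [pauliZ]

theorem pauliX_mul_pauliY : pauliX * pauliY = -(pauliY * pauliX) := by
  ext i j; fin_cases i <;> fin_cases j <;> simp [pauliX, pauliY]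

theorem pauliX_mul_pauliZ : pauliX * pauliZ = -(pauliZ * pauliX) := by
  ext i j; fin_cases i <;> fin_cases j <;> simp [pauliX, pauliZ]

theorem pauliY_mul_pauliZ : pauliY * pauliZ = -(pauliZ * pauliY) := by
  ext i j; fin_cases i <;> fin_cases j <;> simp [pauliY, pauliZ]

theorem majorana_mul_self (n : ℕ) (a : Fin (2 * n)) : majorana n a * majorana n a = 1 := by
  rw [majorana, siteTensor_mul, ← siteTensor_one]
  congr 1
  funext j
  split_ifs
  · exact pauliZ_mul_self
  · exact pauliX_mul_self
  · exact pauliY_mul_self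
  · exact Matrix.one_mul 1

theorem majorana_anticomm_of_lt {n : ℕ} {a b : Fin (2 * n)} (h : a < b) :
    majorana n a * majorana n b = -(majorana n b * majorana n a) := by
  have hab : (a : ℕ) < b := h
  have hj : (a : ℕ) / 2 < n := by omega
  -- The sign is spread over the sites: only the site of `γ_a` contributes `-1`. Before it both
  -- factors are `Z`, and after it `γ_a` is the identity.
  have hprod : (∏ j : Fin n, if j = ⟨(a : ℕ) / 2, hj⟩ then (-1 : ℂ) else 1) = -1 := by simp
  rw [majorana, majorana, siteTensor_mul, siteTensor_mul, ← neg_one_smul ℂ, ← hprod,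
    ← siteTensor_smul]
  congr 1
  funext j
  by_cases hja : j = ⟨(a : ℕ) / 2, hj⟩
  · subst hja
    have h2 : (a : ℕ) / 2 ≤ (b : ℕ) / 2 := by omega
    rcases h2.lt_or_eq with h2 | h2
    · simp only [lt_irrefl, if_false, if_true, h2, neg_one_smul]
      split_ifs
      · exact pauliX_mul_pauliZ
      · exact pauliY_mul_pauliZ
    · have ha : (a : ℕ) % 2 = 0 := by omega
      have hb : ¬ (b : ℕ) % 2 = 0 := by omega
      simp only [lt_irrefl, if_false, if_true, ← h2, ha, hb, neg_one_smul]
      exact pauliX_mul_pauliY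
  · have hja' : (j : ℕ) ≠ (a : ℕ) / 2 := fun h => hja (Fin.ext h)
    rw [if_neg hja, one_smul]
    by_cases h1 : (j : ℕ) < (a : ℕ) / 2
    · have h2 : (j : ℕ) < (b : ℕ) / 2 := by omega
      simp only [h1, h2, if_true]
    · simp only [h1, hja', if_false, Matrix.one_mul, Matrix.mul_one]

theorem majorana_anticomm {n : ℕ} {a b : Fin (2 * n)} (h : a ≠ b) :
    majorana n a * majorana n b = -(majorana n b * majorana n a) := by
  rcases lt_or_gt_of_ne h with h | h
  · exact majorana_anticomm_of_lt h
  · rw [majorana_anticomm_of_lt h, neg_neg]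

theorem trace_majorana_mul_of_ne {n : ℕ} {a b : Fin (2 * n)} (h : a ≠ b) :
    (majorana n a * majorana n b).trace = 0 := by
  have h1 := congrArg trace (majorana_anticomm h)
  rw [trace_neg, trace_mul_comm (majorana n b)] at h1
  exact self_eq_neg.1 h1

theorem majorana_mem_unitaryGroup (n : ℕ) (a : Fin (2 * n)) :
    majorana n a ∈ unitaryGroup (Fin n → Fin 2) ℂ := by
  rw [mem_unitaryGroup_iff, star_eq_conjTranspose, majorana_isHermitian, majorana_mul_self]

theorem trace_majoranaComb_mul {n : ℕ} (c c' : Fin (2 * n) → ℝ) :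
    (majoranaComb c * majoranaComb c').trace = (2 : ℂ) ^ n * ∑ b, (c b : ℂ) * c' b := by
  simp only [majoranaComb, Finset.sum_mul, Finset.mul_sum, trace_sum, smul_mul_smul_comm,
    trace_smul]
  refine Finset.sum_congr rfl fun b _ => ?_
  rw [Finset.sum_eq_single b]
  · simp [majorana_mul_self, mul_comm]
  · intro b' _ hb
    rw [trace_majorana_mul_of_ne hb, smul_zero]
  · simp

/-! ### Matrix entries of Majoranas and their commutant. -/

/-- The bit string `x` with its `j`-th bit flipped. -/
def flipBit {n : ℕ} (j : Fin n) (x : Fin n → Fin 2) : Fin n → Fin 2 :=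
  Function.update x j (1 - x j)

theorem flipBit_flipBit {n : ℕ} (j : Fin n) (x : Fin n → Fin 2) :
    flipBit j (flipBit j x) = x := by
  simp [flipBit]

/-- The sign that the Jordan–Wigner string `Z^{⊗ j}` gives to the bit string `x`. -/
def stringSign {n : ℕ} (j : Fin n) (x : Fin n → Fin 2) : ℂ :=
  ∏ i, if i < j then (if x i = 0 then 1 else -1) else 1

theorem stringSign_congr {n : ℕ} {j : Fin n} {x y : Fin n → Fin 2} (h : ∀ i < j, x i = y i) :
    stringSign j x = stringSign j y := by
  refine Finset.prod_congr rfl fun i _ => ?_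
  split_ifs with h1 <;> simp_all

theorem stringSign_ne_zero {n : ℕ} (j : Fin n) (x : Fin n → Fin 2) : stringSign j x ≠ 0 := by
  refine Finset.prod_ne_zero_iff.2 fun i _ => ?_
  split_ifs <;> simp

theorem stringSign_flipBit {n : ℕ} (j : Fin n) (x : Fin n → Fin 2) :
    stringSign j (flipBit j x) = stringSign j x :=
  stringSign_congr fun _ hi => Function.update_of_ne hi.ne _ _

theorem siteTensor_string_apply {n : ℕ} (j : Fin n) {q : Matrix (Fin 2) (Fin 2) ℂ}
    {c : Fin 2 → ℂ} (hq : ∀ a b, q a b = if b = 1 - a then c a else 0) (x y : Fin n → Fin 2) :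
    siteTensor (fun i : Fin n => if i < j then pauliZ else if i = j then q else 1) x y =
      if y = flipBit j x then c (x j) * stringSign j x else 0 := by
  have hZ : ∀ a : Fin 2, pauliZ a a = if a = 0 then 1 else -1 := by
    intro a; fin_cases a <;> simp [pauliZ]
  have hZ' : ∀ a b : Fin 2, b ≠ a → pauliZ a b = 0 := by
    intro a b; fin_cases a <;> fin_cases b <;> simp [pauliZ]
  rw [siteTensor, of_apply]
  split_ifs with h
  · subst h
    have hc : c (x j) = ∏ i, if i = j then c (x j) else 1 := by simp
    rw [hc, stringSign, ← Finset.prod_mul_distrib]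
    refine Finset.prod_congr rfl fun i _ => ?_
    rcases lt_trichotomy i j with h1 | rfl | h1
    · simp [flipBit, h1, h1.ne, hZ]
    · simp [flipBit, hq]
    · have : flipBit j x i = x i := Function.update_of_ne h1.ne' _ _
      rw [if_neg h1.not_gt, if_neg h1.ne', this, one_apply_eq]
      simp [h1.not_gt, h1.ne']
  · obtain ⟨i, hi⟩ := Function.ne_iff.1 h
    refine Finset.prod_eq_zero (Finset.mem_univ i) ?_
    rcases lt_trichotomy i j with h1 | rfl | h1
    · rw [flipBit, Function.update_of_ne h1.ne] at hi
      simp [h1, hZ' _ _ hi]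
    · rw [flipBit, Function.update_self] at hi
      simp [hq, hi]
    · rw [flipBit, Function.update_of_ne h1.ne'] at hi
      simp [h1.not_gt, h1.ne', one_apply_ne hi.symm]

theorem majorana_even_apply {n : ℕ} (j : Fin n) (x y : Fin n → Fin 2) :
    majorana n ⟨2 * j, by omega⟩ x y = if y = flipBit j x then 1 * stringSign j x else 0 := by
  rw [← siteTensor_string_apply j (q := pauliX) (c := fun _ => 1)]
  · have h : 2 * (j : ℕ) / 2 = j := by omega
    simp [majorana, Fin.ext_iff, h]
  · intro a b; fin_cases a <;> fin_cases b <;> simp [pauliX]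

theorem majorana_odd_apply {n : ℕ} (j : Fin n) (x y : Fin n → Fin 2) :
    majorana n ⟨2 * j + 1, by omega⟩ x y =
      if y = flipBit j x then (if x j = 0 then -I else I) * stringSign j x else 0 := by
  rw [← siteTensor_string_apply j (q := pauliY) (c := fun a => if a = 0 then -I else I)]
  · have h : (2 * (j : ℕ) + 1) / 2 = j := by omega
    have h' : (2 * (j : ℕ) + 1) % 2 = 1 := by omega
    simp [majorana, Fin.ext_iff, h, h']
  · intro a b; fin_cases a <;> fin_cases b <;> simp [pauliY]

/-- Each row and column of `T` is supported on a single bit flip, so either side of `XT = TX` has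
just one term in each entry. -/
theorem apply_flipBit_of_commute {n : ℕ} {j : Fin n} {T X : Operator n} {c : Fin 2 → ℂ}
    (hT : ∀ x y, T x y = if y = flipBit j x then c (x j) * stringSign j x else 0)
    (h : Commute X T) (x y : Fin n → Fin 2) :
    c (1 - y j) * (stringSign j y * X x (flipBit j y)) =
      c (x j) * (stringSign j x * X (flipBit j x) y) := by
  have h1 : (X * T) x y = (T * X) x y := by rw [h.eq]
  rw [mul_apply, mul_apply, Finset.sum_eq_single (flipBit j y),
    Finset.sum_eq_single (flipBit j x)] at h1
  · rw [hT, hT, if_pos (flipBit_flipBit j y).symm, if_pos rfl, stringSign_flipBit] at h1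
    have h2 : flipBit j y j = 1 - y j := Function.update_self ..
    rw [h2] at h1
    linear_combination h1
  · intro z _ hz
    rw [hT, if_neg hz, zero_mul]
  · simp
  · intro z _ hz
    rw [hT, if_neg, mul_zero]
    rintro rfl
    exact hz (flipBit_flipBit j z).symm
  · simp

/-- The `X`-type and `Y`-type Majoranas at site `j` both relate `X x y` to the entry with bit `j`
flipped in both strings. When `x j ≠ y j` the two relations have opposite relative signs. -/
theorem apply_eq_zero_of_commute_majorana {n : ℕ} {j : Fin n} {X : Operator n}
    (h0 : Commute X (majorana n ⟨2 * j, by omega⟩))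
    (h1 : Commute X (majorana n ⟨2 * j + 1, by omega⟩))
    {x y : Fin n → Fin 2} (hxy : x j ≠ y j) : X x y = 0 := by
  have e0 := apply_flipBit_of_commute (c := fun _ => 1) (majorana_even_apply j) h0 x (flipBit j y)
  have e1 := apply_flipBit_of_commute (c := fun a => if a = 0 then -I else I)
    (majorana_odd_apply j) h1 x (flipBit j y)
  have h2 : 1 - flipBit j y j = y j := by simp [flipBit]
  rw [flipBit_flipBit, stringSign_flipBit] at e0 e1
  rw [h2] at e1
  have h3 : (if y j = 0 then -I else I) = -(if x j = 0 then -I else I) := by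
    generalize x j = a at hxy
    generalize y j = b at hxy
    fin_cases a <;> fin_cases b <;> simp at hxy ⊢
  have h4 : (if x j = 0 then -I else I) ≠ 0 := by split_ifs <;> simp
  simp only [h3] at e1
  have h5 : (if x j = 0 then -I else I) * (2 * stringSign j y) * X x y = 0 := by
    linear_combination (if x j = 0 then -I else I) * e0 - e1
  exact (mul_eq_zero.1 h5).resolve_left
    (mul_ne_zero h4 (mul_ne_zero two_ne_zero (stringSign_ne_zero j y)))

/-- Agreement before `j` makes the two string signs equal, so they cancel. -/
theorem apply_flipBit_flipBit_of_commute_majorana {n : ℕ} {j : Fin n} {X : Operator n}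
    (h0 : Commute X (majorana n ⟨2 * j, by omega⟩))
    {x y : Fin n → Fin 2} (hxy : ∀ i < j, x i = y i) : X (flipBit j x) (flipBit j y) = X x y := by
  have e0 := apply_flipBit_of_commute (c := fun _ => 1) (majorana_even_apply j) h0 x (flipBit j y)
  rw [flipBit_flipBit, stringSign_flipBit, stringSign_congr hxy] at e0
  simpa [stringSign_ne_zero] using e0.symm

/-- The bit string `x` with its first `m` bits replaced by `0`. -/
def zeroBits {n : ℕ} (m : ℕ) (x : Fin n → Fin 2) : Fin n → Fin 2 :=
  fun i => if (i : ℕ) < m then 0 else x i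

theorem zeroBits_zero {n : ℕ} (x : Fin n → Fin 2) : zeroBits 0 x = x :=
  funext fun _ => if_neg (Nat.not_lt_zero _)

theorem zeroBits_succ {n : ℕ} (j : Fin n) (x : Fin n → Fin 2) :
    zeroBits (j + 1) x = if x j = 0 then zeroBits j x else flipBit j (zeroBits j x) := by
  funext i
  rcases lt_trichotomy i j with h | rfl | h
  · have h' : (i : ℕ) < j := h
    split_ifs <;> simp [zeroBits, flipBit, h.ne, h', Nat.lt_succ_of_lt h']
  · split_ifs with hx
    · simp [zeroBits, hx]
    · have : 1 - x i = 0 := by generalize x i = a at hx; fin_cases a <;> simp at hx ⊢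
      simp [zeroBits, flipBit, this]
  · have h' : (j : ℕ) < i := h
    have h1 : ¬ (i : ℕ) < j := by omega
    have h2 : ¬ (i : ℕ) < j + 1 := by omega
    split_ifs <;> simp [zeroBits, flipBit, h.ne', h1, h2]

/-- The shared leading bits are cleared one at a time, flipping both strings together. -/
theorem apply_zeroBits_of_commute_majorana {n m : ℕ} (hm : m ≤ n) {X : Operator n}
    (hX : ∀ a : Fin (2 * n), (a : ℕ) < 2 * m → Commute X (majorana n a))
    {x y : Fin n → Fin 2} (hxy : ∀ i : Fin n, (i : ℕ) < m → x i = y i) (k : ℕ) (hk : k ≤ m) :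
    X (zeroBits k x) (zeroBits k y) = X x y := by
  induction k with
  | zero => rw [zeroBits_zero, zeroBits_zero]
  | succ k ih =>
    rw [← ih (by omega)]
    have hkn : k < n := by omega
    have e1 := zeroBits_succ ⟨k, hkn⟩ x
    have e2 := zeroBits_succ ⟨k, hkn⟩ y
    rw [← hxy ⟨k, hkn⟩ (by simpa using hk)] at e2
    simp only at e1 e2
    rw [e1, e2]
    split_ifs
    · rfl
    · refine apply_flipBit_flipBit_of_commute_majorana (hX _ (by simp; omega)) fun i hi => ?_
      have hi' : (i : ℕ) < k := hi
      simp [zeroBits, hi']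

/-- Bit strings of length `n` as pairs of the first `m` bits and the last `n - m` bits. -/
def splitBits {n m : ℕ} (hm : m ≤ n) :
    (Fin n → Fin 2) ≃ (Fin m → Fin 2) × (Fin (n - m) → Fin 2) where
  toFun x := (fun i => x ⟨i, by omega⟩, fun i => x ⟨m + i, by omega⟩)
  invFun p i := if h : (i : ℕ) < m then p.1 ⟨i, h⟩ else p.2 ⟨i - m, by omega⟩
  left_inv x := by
    funext i
    by_cases h : (i : ℕ) < m
    · simp [h]
    · simp only [h, dif_neg, not_false_iff]
      congr 1
      ext
      simp; omega
  right_inv p := by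
    ext i
    · simp
    · simp

theorem idTensor_eq_submatrix {n m : ℕ} (hm : m ≤ n) (u : Operator (n - m)) :
    idTensor m hm u =
      (kroneckerMap (· * ·) (1 : Operator m) u).submatrix (splitBits hm) (splitBits hm) :=
  rfl

theorem idTensor_mul {n m : ℕ} (hm : m ≤ n) (u v : Operator (n - m)) :
    idTensor m hm u * idTensor m hm v = idTensor m hm (u * v) := by
  rw [idTensor_eq_submatrix, idTensor_eq_submatrix, submatrix_mul_equiv, idTensor_eq_submatrix]
  congr 1
  have := mul_kronecker_mul (1 : Operator m) (1 : Operator m) u v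
  rw [Matrix.one_mul] at this
  exact this.symm

theorem conjTranspose_idTensor {n m : ℕ} (hm : m ≤ n) (u : Operator (n - m)) :
    (idTensor m hm u)ᴴ = idTensor m hm uᴴ := by
  rw [idTensor_eq_submatrix, conjTranspose_submatrix, idTensor_eq_submatrix]
  congr 1
  have := conjTranspose_kronecker (1 : Operator m) u
  rw [conjTranspose_one] at this
  exact this

theorem idTensor_one {n m : ℕ} (hm : m ≤ n) : idTensor m hm (1 : Operator (n - m)) = 1 := by
  rw [idTensor_eq_submatrix]
  have : kroneckerMap (· * ·) (1 : Operator m) (1 : Operator (n - m)) = 1 := one_kronecker_one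
  rw [this, submatrix_one_equiv]

theorem idTensor_injective {n m : ℕ} (hm : m ≤ n) :
    Function.Injective (idTensor m hm : Operator (n - m) → Operator n) := by
  intro u v h
  ext p q
  have := congrFun (congrFun h ((splitBits hm).symm (0, p))) ((splitBits hm).symm (0, q))
  simpa [idTensor_eq_submatrix, kroneckerMap_apply] using this

theorem mem_unitaryGroup_of_idTensor_mem {n m : ℕ} (hm : m ≤ n) {u : Operator (n - m)}
    (h : idTensor m hm u ∈ unitaryGroup (Fin n → Fin 2) ℂ) :
    u ∈ unitaryGroup (Fin (n - m) → Fin 2) ℂ := by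
  rw [mem_unitaryGroup_iff, star_eq_conjTranspose] at h ⊢
  rw [conjTranspose_idTensor, idTensor_mul, ← idTensor_one hm] at h
  exact idTensor_injective hm h

/-- The commutant of the first `2 m` Majorana operators consists of the operators on the last
`n - m` modes. -/
theorem exists_eq_idTensor_of_commute_majorana {n m : ℕ} (hm : m ≤ n) {X : Operator n}
    (hX : ∀ a : Fin (2 * n), (a : ℕ) < 2 * m → Commute X (majorana n a)) :
    ∃ u, X = idTensor m hm u := by
  -- The operator `u` is the block of `X` whose first `m` bits are `0` on both sides.
  refine ⟨of fun p q => X ((splitBits hm).symm (0, p)) ((splitBits hm).symm (0, q)), ?_⟩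
  have hz : ∀ x, (splitBits hm).symm (0, (splitBits hm x).2) = zeroBits m x := by
    intro x
    rw [Equiv.symm_apply_eq]
    ext i
    · simp [splitBits, zeroBits]
    · simp [splitBits, zeroBits]
  ext x y
  rw [idTensor_eq_submatrix, submatrix_apply, kroneckerMap_apply, of_apply, hz, hz]
  by_cases hxy : ∀ i : Fin n, (i : ℕ) < m → x i = y i
  · have : (splitBits hm x).1 = (splitBits hm y).1 := funext fun i => hxy _ i.2
    rw [this, one_apply_eq, one_mul, apply_zeroBits_of_commute_majorana hm hX hxy m le_rfl]
  · push Not at hxy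
    obtain ⟨i, hi, hne⟩ := hxy
    have : (splitBits hm x).1 ≠ (splitBits hm y).1 := fun h => hne (congrFun h ⟨i, hi⟩)
    rw [one_apply_ne this, zero_mul]
    exact apply_eq_zero_of_commute_majorana (hX _ (by simp; omega)) (hX _ (by simp; omega)) hne

/-! ### Averaging onto the commutant. -/

/-- Conjugation `Y ↦ γ_a Y γ_a` by a Majorana operator. -/
def majoranaConj {n : ℕ} (a : Fin (2 * n)) : Operator n →ₗ[ℂ] Operator n where
  toFun Y := majorana n a * Y * majorana n a
  map_add' Y Z := by rw [mul_add, add_mul]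
  map_smul' c Y := by simp

theorem majoranaConj_apply {n : ℕ} (a : Fin (2 * n)) (Y : Operator n) :
    majoranaConj a Y = majorana n a * Y * majorana n a := rfl

theorem majoranaConj_majoranaConj {n : ℕ} (a : Fin (2 * n)) (Y : Operator n) :
    majoranaConj a (majoranaConj a Y) = Y := by
  simp only [majoranaConj_apply, Matrix.mul_assoc, majorana_mul_self, Matrix.mul_one]
  rw [← Matrix.mul_assoc, majorana_mul_self, Matrix.one_mul]

/-- The anticommutation signs on the left and on the right cancel. -/
theorem majoranaConj_comm {n : ℕ} (a b : Fin (2 * n)) (Y : Operator n) :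
    majoranaConj a (majoranaConj b Y) = majoranaConj b (majoranaConj a Y) := by
  by_cases h : a = b
  · rw [h]
  · have e1 : ∀ c d : Fin (2 * n), majoranaConj c (majoranaConj d Y) =
        (majorana n c * majorana n d) * Y * (majorana n d * majorana n c) := by
      intro c d
      simp only [majoranaConj_apply, Matrix.mul_assoc]
    rw [e1, e1, majorana_anticomm h, majorana_anticomm (Ne.symm h)]
    simp

theorem hsInner_majoranaConj {n : ℕ} (a : Fin (2 * n)) (Y Z : Operator n) :
    hsInner (majoranaConj a Y) (majoranaConj a Z) = hsInner Y Z :=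
  hsInner_unitary_mul_mul (majorana_mem_unitaryGroup n a) (majorana_mem_unitaryGroup n a) Y Z

theorem hsInner_majoranaConj_left {n : ℕ} (a : Fin (2 * n)) (Y Z : Operator n) :
    hsInner (majoranaConj a Y) Z = hsInner Y (majoranaConj a Z) := by
  rw [← hsInner_majoranaConj a Y, majoranaConj_majoranaConj]

theorem commute_majorana_of_majoranaConj_eq {n : ℕ} {a : Fin (2 * n)} {Y : Operator n}
    (h : majoranaConj a Y = Y) : Commute Y (majorana n a) := by
  have h1 : majorana n a * (majorana n a * Y * majorana n a) = majorana n a * Y :=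
    congrArg _ h
  rwa [← Matrix.mul_assoc, ← Matrix.mul_assoc, majorana_mul_self, Matrix.one_mul] at h1

/-- The average `(Y + γ_a Y γ_a) / 2`. -/
def majoranaAverage {n : ℕ} (a : Fin (2 * n)) (Y : Operator n) : Operator n :=
  ((1 - 1 / 2 : ℝ) : ℂ) • Y + ((1 / 2 : ℝ) : ℂ) • majoranaConj a Y

theorem majoranaConj_majoranaAverage_self {n : ℕ} (a : Fin (2 * n)) (Y : Operator n) :
    majoranaConj a (majoranaAverage a Y) = majoranaAverage a Y := by
  rw [majoranaAverage, map_add, map_smul, map_smul, majoranaConj_majoranaConj, add_comm]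
  norm_num

theorem majoranaConj_majoranaAverage {n : ℕ} (a b : Fin (2 * n)) (Y : Operator n) :
    majoranaConj a (majoranaAverage b Y) = majoranaAverage b (majoranaConj a Y) := by
  rw [majoranaAverage, map_add, map_smul, map_smul, majoranaConj_comm, majoranaAverage]

theorem majoranaAverage_sub {n : ℕ} (a : Fin (2 * n)) (Y Z : Operator n) :
    majoranaAverage a (Y - Z) = majoranaAverage a Y - majoranaAverage a Z := by
  simp only [majoranaAverage, map_sub, smul_sub]
  abel

/-- Pythagoras: conjugation is a self-adjoint involution, so the average is an orthogonal projection
with residual `(Y - γ_a Y γ_a) / 2`. -/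
theorem hsInner_self_sub_majoranaAverage {n : ℕ} (a : Fin (2 * n)) (Y : Operator n) :
    hsInner Y Y - hsInner (majoranaAverage a Y) (majoranaAverage a Y) =
      hsInner (Y - majoranaConj a Y) (Y - majoranaConj a Y) / 4 := by
  simp only [majoranaAverage, hsInner_add_left, hsInner_add_right, hsInner_smul_left,
    hsInner_smul_right, hsInner_sub_left, hsInner_sub_right, hsInner_majoranaConj_left,
    majoranaConj_majoranaConj]
  ring

theorem hsInner_majoranaAverage_of_majoranaConj_eq {n : ℕ} {a : Fin (2 * n)} {Y : Operator n}
    (h : majoranaConj a Y = Y) (Z : Operator n) :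
    hsInner Y (majoranaAverage a Z) = hsInner Y Z := by
  rw [majoranaAverage, hsInner_add_right, hsInner_smul_right, hsInner_smul_right,
    ← hsInner_majoranaConj_left, h]
  ring

open scoped ComplexOrder in
theorem posSemidef_one_sub_of_unitary {d : Type*} [Fintype d] [DecidableEq d] {W : Matrix d d ℂ}
    (hW : W ∈ unitaryGroup d ℂ) : (1 - Wᴴ * W).PosSemidef := by
  have h : Wᴴ * W = 1 := mem_unitaryGroup_iff'.1 hW
  rw [h, sub_self]
  exact PosSemidef.zero

open scoped ComplexOrder in
theorem posSemidef_one_sub_majoranaAverage {n : ℕ} (a : Fin (2 * n)) {Y : Operator n}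
    (h : (1 - Yᴴ * Y).PosSemidef) :
    (1 - (majoranaAverage a Y)ᴴ * majoranaAverage a Y).PosSemidef := by
  -- Here `t = 1 / 2`; the weight `1 - 1 / 2` in `majoranaAverage` is kept unsimplified to fit.
  refine posSemidef_one_sub_of_convex_comb (by norm_num) (by norm_num) h ?_
  have h1 := h.conjTranspose_mul_mul_same (majorana n a)
  have h2 : (majorana n a)ᴴ * (1 - Yᴴ * Y) * majorana n a =
      1 - (majoranaConj a Y)ᴴ * majoranaConj a Y := by
    have h3 : (majoranaConj a Y)ᴴ * majoranaConj a Y =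
        majorana n a * Yᴴ * (majorana n a * majorana n a) * (Y * majorana n a) := by
      simp only [majoranaConj_apply, conjTranspose_mul, majorana_isHermitian, Matrix.mul_assoc]
    rw [h3, majorana_mul_self, majorana_isHermitian, mul_sub, sub_mul, Matrix.mul_one,
      Matrix.mul_one, majorana_mul_self]
    simp only [Matrix.mul_assoc]
  rwa [h2] at h1

open scoped ComplexOrder in
/-- The orthogonal projection of a contraction `X` onto the commutant of a set of Majorana
operators, obtained by averaging over the conjugations. -/
theorem exists_commutant_projection {n : ℕ} {X : Operator n} (hX : (1 - Xᴴ * X).PosSemidef)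
    (S : Finset (Fin (2 * n))) :
    ∃ E : Operator n, (∀ a ∈ S, majoranaConj a E = E) ∧ (1 - Eᴴ * E).PosSemidef ∧
      (∀ Y : Operator n, (∀ a ∈ S, majoranaConj a Y = Y) → hsInner Y E = hsInner Y X) ∧
      (∀ a, hsInner (E - majoranaConj a E) (E - majoranaConj a E) ≤
        hsInner (X - majoranaConj a X) (X - majoranaConj a X)) ∧
      hsInner X X - hsInner E E ≤
        ∑ a ∈ S, hsInner (X - majoranaConj a X) (X - majoranaConj a X) / 4 := by
  -- The defect bound holds for every `a`, not only those in `S`: the next index `b` lies outside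
  -- `S`, and the loss from averaging over it must be bounded by the defect of the original `X`.
  induction S using Finset.induction_on with
  | empty => exact ⟨X, by simp, hX, by simp, by simp, by simp⟩
  | insert b S hb ih =>
    obtain ⟨E, h1, h2, h3, h4, h5⟩ := ih
    refine ⟨majoranaAverage b E, ?_, posSemidef_one_sub_majoranaAverage b h2, ?_, ?_, ?_⟩
    · intro a ha
      rcases Finset.mem_insert.1 ha with rfl | ha
      · exact majoranaConj_majoranaAverage_self a E
      · rw [majoranaConj_majoranaAverage, h1 a ha]
    · intro Y hY
      rw [hsInner_majoranaAverage_of_majoranaConj_eq (hY b (Finset.mem_insert_self b S)),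
        h3 Y fun a ha => hY a (Finset.mem_insert_of_mem ha)]
    · intro a
      refine le_trans ?_ (h4 a)
      rw [majoranaConj_majoranaAverage, ← majoranaAverage_sub]
      have e1 := hsInner_self_sub_majoranaAverage b (E - majoranaConj a E)
      have e2 := hsInner_self_nonneg (E - majoranaConj a E - majoranaConj b (E - majoranaConj a E))
      linarith
    · rw [Finset.sum_insert hb]
      have e1 := hsInner_self_sub_majoranaAverage b E
      have e2 := h4 b
      linarith

/-! ### Rounding to a commuting unitary. -/

/-- Singularity would make `-t / (1 - t)` an eigenvalue of `E`. This value is injective in `t`, and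
the spectrum is finite. -/
theorem exists_isUnit_convex_comb_one {d : Type*} [Fintype d] [DecidableEq d]
    (E : Matrix d d ℂ) {ε : ℝ} (hε : 0 < ε) :
    ∃ t : ℝ, 0 < t ∧ t < 1 ∧ t < ε ∧
      IsUnit (((1 - t : ℝ) : ℂ) • E + (t : ℂ) • (1 : Matrix d d ℂ)) := by
  have hinj : Set.InjOn (fun t : ℝ => ((-(t / (1 - t)) : ℝ) : ℂ)) (Set.Ioo 0 (min 1 ε)) := by
    intro s hs t ht hst
    have h1 : 1 - s ≠ 0 := (sub_pos.2 (lt_of_lt_of_le hs.2 (min_le_left _ _))).ne'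
    have h2 : 1 - t ≠ 0 := (sub_pos.2 (lt_of_lt_of_le ht.2 (min_le_left _ _))).ne'
    have h3 := neg_injective (Complex.ofReal_injective hst)
    rw [div_eq_div_iff h1 h2] at h3
    linarith
  have hinf := (Set.Ioo_infinite (lt_min one_pos hε)).image hinj
  obtain ⟨z, ⟨t, ht, rfl⟩, hz⟩ := hinf.exists_notMem_finite (Matrix.finite_spectrum (R := ℂ) E)
  have ht1 : t < 1 := lt_of_lt_of_le ht.2 (min_le_left _ _)
  refine ⟨t, ht.1, ht1, lt_of_lt_of_le ht.2 (min_le_right _ _), ?_⟩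
  have h1 : ((-(1 - t) : ℝ) : ℂ) ≠ 0 := by
    rw [Complex.ofReal_ne_zero]; linarith
  have h2 := (spectrum.notMem_iff.1 hz).smul (Units.mk0 _ h1)
  convert h2 using 1
  have h3 : -(1 - t) * -(t / (1 - t)) = t := by
    have : 1 - t ≠ 0 := by linarith
    field_simp
  rw [Units.smul_mk0, smul_sub, Algebra.algebraMap_eq_smul_one, smul_smul, ← Complex.ofReal_mul, h3,
    Complex.ofReal_neg]
  module

/-- A unitary that nearly commutes with some Majorana operators is close to a unitary that commutes
with them. -/
theorem exists_unitary_commute_majorana {n : ℕ} {X : Operator n}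
    (hX : X ∈ unitaryGroup (Fin n → Fin 2) ℂ) (S : Finset (Fin (2 * n))) {δ : ℝ}
    (hδ : ∑ a ∈ S, hsInner (X - majoranaConj a X) (X - majoranaConj a X) / 4 ≤ δ) :
    ∃ W ∈ unitaryGroup (Fin n → Fin 2) ℂ, (∀ a ∈ S, Commute W (majorana n a)) ∧
      hsInner (X - W) (X - W) ≤ 5 * δ := by
  obtain ⟨E, hE1, hE2, hE3, -, hE5⟩ :=
    exists_commutant_projection (posSemidef_one_sub_of_unitary hX) S
  have hEE : hsInner E X = hsInner E E := (hE3 E hE1).symm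
  have hN := hsInner_self_of_mem_unitaryGroup hX
  have hD : hsInner (X - E) (X - E) ≤ δ := by
    rw [hsInner_sub_left, hsInner_sub_right, hsInner_sub_right, hsInner_comm X E, hEE]
    linarith
  have hEc : ∀ a ∈ S, Commute E (majorana n a) := fun a ha =>
    commute_majorana_of_majoranaConj_eq (hE1 a ha)
  -- The perturbation needs strict room above `2δ`; for `δ ≤ 0` there is none, but then `X = E`
  -- already commutes.
  rcases le_or_gt δ 0 with h0 | h0
  · have h1 := sub_eq_zero.1 (eq_zero_of_hsInner_self_nonpos (hD.trans h0))
    have h2 : δ = 0 := le_antisymm h0 ((hsInner_self_nonneg _).trans hD)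
    refine ⟨X, hX, h1 ▸ hEc, ?_⟩
    rw [sub_self, h2]
    simp [hsInner]
  · have hg : Continuous fun t : ℝ =>
        hsInner (X - (((1 - t : ℝ) : ℂ) • E + (t : ℂ) • (1 : Operator n)))
            (X - (((1 - t : ℝ) : ℂ) • E + (t : ℂ) • (1 : Operator n))) +
          (hsInner X X - hsInner (((1 - t : ℝ) : ℂ) • E + (t : ℂ) • (1 : Operator n))
            (((1 - t : ℝ) : ℂ) • E + (t : ℂ) • (1 : Operator n))) := by
      simp only [hsInner_add_left, hsInner_add_right, hsInner_smul_left,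
        hsInner_smul_right, hsInner_sub_left, hsInner_sub_right]
      fun_prop
    -- At `t = 0` the two terms sum to at most `2δ`, so by continuity they stay below `5δ/2` for
    -- small `t`.
    obtain ⟨ε, hε, hball⟩ := Metric.eventually_nhds_iff.1 <|
      hg.continuousAt.eventually_lt (continuousAt_const (y := 5 / 2 * δ)) (x₀ := 0) (by
        simp only [sub_zero, Complex.ofReal_one, Complex.ofReal_zero, one_smul, zero_smul, add_zero]
        linarith)
    obtain ⟨t, ht0, ht1, htε, hu⟩ := exists_isUnit_convex_comb_one E hε
    have hb := hball (y := t) (by rwa [Real.dist_eq, sub_zero, abs_of_pos ht0])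
    have hpsd := posSemidef_one_sub_of_convex_comb ht0.le ht1.le hE2
      (posSemidef_one_sub_of_unitary (one_mem (unitaryGroup (Fin n → Fin 2) ℂ)))
    set B := ((1 - t : ℝ) : ℂ) • E + (t : ℂ) • (1 : Operator n) with hB
    obtain ⟨W, hW, hWc, hBW⟩ := exists_unitary_polar_factor hu hpsd
    refine ⟨W, hW, fun a ha => ?_, ?_⟩
    · have hc : Commute B (majorana n a) :=
        ((hEc a ha).smul_left _).add_left ((Commute.one_left _).smul_left _)
      refine hWc _ hc ?_
      have := congrArg conjTranspose hc.eq
      rw [conjTranspose_mul, conjTranspose_mul, majorana_isHermitian] at this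
      exact this.symm
    -- Nonnegativity of `‖P - Q‖²` gives `‖P + Q‖² ≤ 2‖P‖² + 2‖Q‖²`, which doubles `5δ/2` to `5δ`.
    · have e1 := hsInner_self_nonneg (X - B - (B - W))
      have e2 : X - W = (X - B) + (B - W) := by abel
      rw [e2]
      generalize X - B = P at *
      generalize B - W = Q at *
      simp only [hsInner_add_left, hsInner_add_right, hsInner_sub_left,
        hsInner_sub_right] at e1 ⊢
      rw [← hN] at hBW
      linarith

/-! ### Gaussian unitaries, singular values and distance. -/

theorem IsGaussianOf.conj_majoranaComb {n : ℕ} {G : Operator n}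
    {V : Matrix (Fin (2 * n)) (Fin (2 * n)) ℝ} (h : IsGaussianOf G V) (a : Fin (2 * n)) :
    Gᴴ * (majoranaComb fun b => V b a) * G = majorana n a := by
  have h1 : Gᴴ * G = 1 := mem_unitaryGroup_iff'.1 h.1
  have h2 : Gᴴ * (G * majorana n a * Gᴴ) * G = (Gᴴ * G) * majorana n a * (Gᴴ * G) := by
    simp only [Matrix.mul_assoc]
  rw [← h.2.2 a, h2, h1, Matrix.one_mul, Matrix.mul_one]

/-- The diagonal of the correlation matrix of `G_A† U G_B`. -/
theorem hsInner_majoranaConj_of_isGaussianOf {n : ℕ} {U GA GB : Operator n}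
    {VA VB : Matrix (Fin (2 * n)) (Fin (2 * n)) ℝ} (hA : IsGaussianOf GA VA)
    (hB : IsGaussianOf GB VB) (a : Fin (2 * n)) :
    hsInner (GAᴴ * U * GB) (majoranaConj a (GAᴴ * U * GB)) =
      2 ^ n * (VAᵀ * correlationMatrix U * VB) a a := by
  have e1 : (GAᴴ * U * GB)ᴴ * majoranaConj a (GAᴴ * U * GB) =
      (GBᴴ * Uᴴ * (GA * majorana n a * GAᴴ) * U) * (GB * majorana n a) := by
    simp only [majoranaConj_apply, conjTranspose_mul, conjTranspose_conjTranspose,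
      Matrix.mul_assoc]
  have e2 : (GB * majorana n a) * (GBᴴ * Uᴴ * (GA * majorana n a * GAᴴ) * U) =
      (GB * majorana n a * GBᴴ) * Uᴴ * (GA * majorana n a * GAᴴ) * U := by
    simp only [Matrix.mul_assoc]
  have e3 : ∀ b c, (majorana n c * Uᴴ * majorana n b * U).trace =
      (2 : ℂ) ^ n * (correlationMatrix U b c : ℂ) := by
    intro b c
    have e4 : majorana n c * Uᴴ * majorana n b * U = (majorana n c * Uᴴ) * (majorana n b * U) := by
      simp only [Matrix.mul_assoc]
    rw [ofReal_correlationMatrix, mul_inv_cancel_left₀ (by simp), e4, trace_mul_comm]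
    simp only [Matrix.mul_assoc]
  rw [hsInner, e1, trace_mul_comm, e2, hA.2.2, hB.2.2]
  simp only [majoranaComb, Finset.sum_mul, Finset.mul_sum, smul_mul_assoc, mul_smul_comm,
    trace_sum, trace_smul, e3, mul_apply, transpose_apply, re_sum]
  rw [Finset.sum_comm]
  refine Finset.sum_congr rfl fun c _ => ?_
  rw [smul_eq_mul, Finset.mul_sum, re_sum]
  refine Finset.sum_congr rfl fun b _ => ?_
  rw [smul_eq_mul]
  norm_cast
  ring

theorem sigma_antitone {d : ℕ} (M : Matrix (Fin d) (Fin d) ℝ) : Antitone (sigma M) :=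
  fun _ _ h => (Matrix.toEuclideanLin M).singularValues_antitone (Nat.sub_le_sub_right h 1)

theorem frobeniusDist_le {n : ℕ} (U V : Operator n) :
    frobeniusDist U V ≤ (√(2 * (2 : ℝ) ^ n))⁻¹ * √(hsInner (U - V) (U - V)) := by
  refine mul_le_mul_of_nonneg_left ?_ (by positivity)
  -- The phase `θ = 0` suffices.
  refine (ciInf_le ⟨0, ?_⟩ ⟨0, le_rfl, by positivity⟩).trans_eq ?_
  · rintro _ ⟨θ, rfl⟩
    exact @norm_nonneg _ (Matrix.frobeniusSeminormedAddCommGroup).toSeminormedAddGroup _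
  · rw [← frobenius_norm_sq_eq_hsInner, Real.sqrt_sq]
    · simp
    · exact @norm_nonneg _ (Matrix.frobeniusSeminormedAddCommGroup).toSeminormedAddGroup _

theorem sum_one_sub_le {k ℓ : ℕ} {f : ℕ → ℝ} {τ : ℝ} (h1 : ∀ a < k, f a = 1)
    (h2 : ∀ a < k + ℓ, 1 - τ ≤ f a) : ∑ a ∈ Finset.range (k + ℓ), (1 - f a) ≤ ℓ * τ := by
  rw [Finset.sum_range_add, Finset.sum_eq_zero, zero_add]
  · refine (Finset.sum_le_card_nsmul _ _ τ fun a ha => ?_).trans_eq (by simp)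
    have := h2 (k + a) (by have := Finset.mem_range.1 ha; omega)
    linarith
  · intro a ha
    rw [h1 a (Finset.mem_range.1 ha), sub_self]

/-- A unitary that commutes with `m` Majorana operators has Gaussian dimension at least `m`, also
between two Gaussian unitaries. -/
theorem hasGaussianDimension_of_commute {n m : ℕ} (hm : m ≤ 2 * n) {W GA GB : Operator n}
    {VA VB : Matrix (Fin (2 * n)) (Fin (2 * n)) ℝ} (hA : IsGaussianOf GA VA)
    (hB : IsGaussianOf GB VB) (hW : W ∈ unitaryGroup (Fin n → Fin 2) ℂ)
    (hWc : ∀ a : Fin (2 * n), (a : ℕ) < m → Commute W (majorana n a)) :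
    HasGaussianDimension (GA * W * GBᴴ) m := by
  have hcol : ∀ {V : Matrix (Fin (2 * n)) (Fin (2 * n)) ℝ},
      V ∈ orthogonalGroup (Fin (2 * n)) ℝ → ∀ a a', ∑ b, V b a * V b a' =
        (1 : Matrix _ _ ℝ) a a' := by
    intro V hV a a'
    have h : Vᵀ * V = 1 := (mem_orthogonalGroup_iff' _ _).1 hV
    rw [← h, mul_apply]
    rfl
  -- Take `η_a = G_B γ_a G_B†`: undoing `G_B` leaves `γ_a`, which passes through `W` and is rotated
  -- by `G_A` into a column of `VA`.
  refine ⟨of fun b a => VB b (Fin.castLE hm a), of fun b a => VA b (Fin.castLE hm a),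
    fun a => ?_, fun a a' h => ?_, fun a => ⟨?_, ?_⟩⟩
  · simpa [sq] using hcol hB.2.1 (Fin.castLE hm a) (Fin.castLE hm a)
  · have h1 := hcol hB.2.1 (Fin.castLE hm a) (Fin.castLE hm a')
    rw [one_apply_ne fun h2 => h (Fin.castLE_injective hm h2)] at h1
    rw [trace_majoranaComb_mul]
    simp only [of_apply]
    norm_cast
    rw [h1, mul_zero]
  · simpa [sq] using hcol hA.2.1 (Fin.castLE hm a) (Fin.castLE hm a)
  · simp only [of_apply]
    have hWW : W * Wᴴ = 1 := mem_unitaryGroup_iff.1 hW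
    rw [← hA.2.2, conjTranspose_mul, conjTranspose_mul, conjTranspose_conjTranspose]
    have e1 : GA * W * GBᴴ * (majoranaComb fun b => VB b (Fin.castLE hm a)) * (GB * (Wᴴ * GAᴴ)) =
        GA * (W * (GBᴴ * (majoranaComb fun b => VB b (Fin.castLE hm a)) * GB)) * Wᴴ * GAᴴ := by
      simp only [Matrix.mul_assoc]
    rw [e1, hB.conj_majoranaComb, (hWc _ a.2).eq, ← Matrix.mul_assoc, Matrix.mul_assoc _ W, hWW,
      Matrix.mul_one]

end Fermion

end

theorem mainTheorem5 (n k ℓ : ℕ) (hkℓ : k + ℓ ≤ 2 * n) (τ : ℝ)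
    (U : Fermion.Operator n) (hU : U ∈ Matrix.unitaryGroup (Fin n → Fin 2) ℂ)
    (VA VB : Matrix (Fin (2 * n)) (Fin (2 * n)) ℝ)
    (GA GB : Fermion.Operator n)
    (hA : Fermion.IsGaussianOf GA VA) (hB : Fermion.IsGaussianOf GB VB)
    (hSVD : Fermion.correlationMatrix U =
      VA * Matrix.diagonal
          (fun i : Fin (2 * n) => Fermion.sigma (Fermion.correlationMatrix U) (i + 1)) *
        VB.transpose)
    (hone : ∀ a : ℕ, 1 ≤ a → a ≤ k → Fermion.sigma (Fermion.correlationMatrix U) a = 1)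
    (hτ : 1 ≤ k + ℓ → 1 - τ ≤ Fermion.sigma (Fermion.correlationMatrix U) (k + ℓ)) :
    ∃ U' ∈ Matrix.unitaryGroup (Fin n → Fin 2) ℂ,
      (∃ u' ∈ Matrix.unitaryGroup (Fin (n - (k + ℓ) / 2) → Fin 2) ℂ,
        U' = GA * Fermion.idTensor ((k + ℓ) / 2) (by omega) u' * GB.conjTranspose) ∧
      Fermion.HasGaussianDimension U' (k + ℓ) ∧
      Fermion.frobeniusDist U U' ≤ 2 * Real.sqrt (ℓ * τ) := by
  open Fermion Matrix in
  have hGA1 : GA * GAᴴ = 1 := mem_unitaryGroup_iff.1 hA.1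
  have hGB1 : GB * GBᴴ = 1 := mem_unitaryGroup_iff.1 hB.1
  have hGA' : GAᴴ ∈ unitaryGroup (Fin n → Fin 2) ℂ := Unitary.star_mem hA.1
  have hGB' : GBᴴ ∈ unitaryGroup (Fin n → Fin 2) ℂ := Unitary.star_mem hB.1
  have hX : GAᴴ * U * GB ∈ unitaryGroup (Fin n → Fin 2) ℂ := mul_mem (mul_mem hGA' hU) hB.1
  have hdiag : VAᵀ * correlationMatrix U * VB =
      diagonal fun i : Fin (2 * n) => sigma (correlationMatrix U) (i + 1) := by
    have h1 : VAᵀ * VA = 1 := (mem_orthogonalGroup_iff' _ _).1 hA.2.1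
    have h2 : VBᵀ * VB = 1 := (mem_orthogonalGroup_iff' _ _).1 hB.2.1
    generalize (diagonal fun i : Fin (2 * n) => sigma (correlationMatrix U) (i + 1)) = D at hSVD ⊢
    have h3 : VAᵀ * (VA * D * VBᵀ) * VB = (VAᵀ * VA) * D * (VBᵀ * VB) := by
      simp only [Matrix.mul_assoc]
    rw [hSVD, h3, h1, h2, Matrix.one_mul, Matrix.mul_one]
  have hdef : ∀ a : Fin (2 * n), hsInner (GAᴴ * U * GB - majoranaConj a (GAᴴ * U * GB))
      (GAᴴ * U * GB - majoranaConj a (GAᴴ * U * GB)) / 4 =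
        2 ^ n / 2 * (1 - sigma (correlationMatrix U) (a + 1)) := by
    intro a
    have h1 := hsInner_majoranaConj_of_isGaussianOf (U := U) hA hB a
    rw [hdiag, diagonal_apply_eq] at h1
    rw [hsInner_sub_left, hsInner_sub_right, hsInner_sub_right, hsInner_majoranaConj,
      hsInner_majoranaConj_left, h1, hsInner_self_of_mem_unitaryGroup hX]
    simp
    ring
  have hsum : ∑ a ∈ Finset.univ.map (Fin.castLEEmb hkℓ),
      hsInner (GAᴴ * U * GB - majoranaConj a (GAᴴ * U * GB))
        (GAᴴ * U * GB - majoranaConj a (GAᴴ * U * GB)) / 4 ≤ 2 ^ n / 2 * (ℓ * τ) := by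
    rw [Finset.sum_congr rfl fun a _ => hdef a, ← Finset.mul_sum, Finset.sum_map]
    simp only [Fin.castLEEmb_apply, Fin.val_castLE]
    rw [Fin.sum_univ_eq_sum_range fun a => 1 - sigma (correlationMatrix U) (a + 1)]
    -- `σ` is numbered from `1`, the indices `a` from `0`. The bound on `σ_{k+ℓ}` reaches the
    -- earlier values by monotonicity.
    refine mul_le_mul_of_nonneg_left (sum_one_sub_le (fun a ha => hone _ (by omega) (by omega))
      fun a ha => (hτ (by omega)).trans (sigma_antitone _ (by omega))) (by positivity)
  obtain ⟨W, hW, hWc, hXW⟩ := exists_unitary_commute_majorana hX _ hsum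
  have hWc' : ∀ a : Fin (2 * n), (a : ℕ) < k + ℓ → Commute W (majorana n a) := fun a ha =>
    hWc a (Finset.mem_map.2 ⟨⟨a, ha⟩, Finset.mem_univ _, rfl⟩)
  -- If `k + ℓ` is odd, the last Majorana is not needed for the tensor form; it still counts for the
  -- Gaussian dimension.
  obtain ⟨u, hu⟩ := exists_eq_idTensor_of_commute_majorana (m := (k + ℓ) / 2) (by omega)
    fun a ha => hWc' a (by omega)
  refine ⟨GA * W * GBᴴ, mul_mem (mul_mem hA.1 hW) hGB',
    ⟨u, mem_unitaryGroup_of_idTensor_mem _ (hu ▸ hW), by rw [hu]⟩,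
    hasGaussianDimension_of_commute hkℓ hA hB hW hWc', ?_⟩
  have hUX : U - GA * W * GBᴴ = GA * (GAᴴ * U * GB - W) * GBᴴ := by
    have h1 : GA * (GAᴴ * U * GB) * GBᴴ = (GA * GAᴴ) * U * (GB * GBᴴ) := by
      simp only [Matrix.mul_assoc]
    rw [mul_sub, sub_mul, h1, hGA1, hGB1, Matrix.one_mul, Matrix.mul_one]
  refine (frobeniusDist_le _ _).trans ?_
  rw [hUX, hsInner_unitary_mul_mul hA.1 hGB', inv_mul_le_iff₀ (by positivity)]
  have h0 := (hsInner_self_nonneg _).trans hXW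
  have hpow : (0 : ℝ) < 2 ^ n := by positivity
  -- The sign of `τ` is not assumed: it is forced, when `ℓ > 0`, by the nonnegative squared norm
  -- bounded by `5δ`.
  have hL : 0 ≤ (ℓ : ℝ) * τ := by
    by_contra! h
    nlinarith
  have h2 : (2 : ℝ) * √(ℓ * τ) = √(4 * (ℓ * τ)) := by
    rw [show (4 : ℝ) = 2 ^ 2 by norm_num, Real.sqrt_mul (by positivity) (ℓ * τ),
      Real.sqrt_sq zero_le_two]
  rw [h2, ← Real.sqrt_mul (by positivity)]
  refine Real.sqrt_le_sqrt (hXW.trans ?_)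
  -- The comparison is `(5/2) 2^n ℓτ ≤ 8 · 2^n ℓτ`, with room to spare.
  nlinarith [mul_nonneg hpow.le hL]
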